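/- Let $\mathcal A$ be a category and $\mathcal E$ a class of morphisms in $\mathcal A$. Consider the axioms - (E1) $\mathcal E$ contains all isomorphisms; - (E2) for $g\in\mathcal E$, the pullback of $g$ along any morphism with the same codomain exists and is in $\mathcal E$; - (E3) $\mathcal E$ is closed under composition; - (E4) if $g\circ f\in\mathcal E$ then $g\in\mathcal E$; - (E5) (relative Mal'tsev axiom) if $a\colon A_1\to A_0$ and $b\colon B_1\to B_0$ are in $\mathcal E$ and $(f_1,f_0)\colon a\to b$ is a split epimorphism in the category of arrows (so $bf_1=f_0a$, and there are $s_1,s_0$ with $as_1=s_0b$, $f_1s_1=1$, $f_0s_0=1$), then this square is a double extension, i.e. $a,b,f_1,f_0$, the two projections of the pullback $A_0\times_{B_0}B_1$, and the comparison morphism $\langle a,f_1\rangle\colon A_1\to A_0\times_{B_0}B_1$ are all in $\mathcal E$. A *simplicial kernel* of morphisms $f_0,\dots,f_n\colon X\to Y$ ($n\ge 0$) is a universal sequence $k_0,\dots,k_{n+1}\colon K\to X$ with $f_ik_j=f_{j-1}k_i$ for $0\le i<j\le n+1$. A *semi-simplicial object* consists of objects $(A_n)_{n\ge 0}$ and faces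 $\partial_i\colon A_n\to A_{n-1}$ ($n\ge 1$, $0\le i\le n$) with $\partial_i\partial_j=\partial_{j-1}\partial_i$ for $i<j$. A *quasi-simplicial object* has moreover degeneracies $\sigma_i\colon A_n\to A_{n+1}$ ($0\le i\le n$) with $\partial_i\sigma_j=\sigma_{j-1}\partial_i$ for $i<j$, $\partial_j\sigma_j=\partial_{j+1}\sigma_j=1$, and $\partial_i\sigma_j=\sigma_j\partial_{i-1}$ for $i>j+1$; it is a *simplicial object* if also $\sigma_i\sigma_j=\sigma_{j+1}\sigma_i$ for $i\le j$. For $n\ge 2$ and $0\le k\le n$, the *object of $(n,k)$-horns* of a semi-simplicial object is an object $A(n,k)$ with a universal family of morphisms $a_i\colon A(n,k)\to A_{n-1}$ ($0\le i\le n$, $i\ne k$) satisfying $\partial_ia_j=\partial_{j-1}a_i$ for $i<j$ with $i,j\neq k$. A semi-simplicial object is *$\mathcal E$-Kan* if $\partial_0,\partial_1\colon A_1\to A_0$ are in $\mathcal E$ and, for all $n\ge 2$ and $0\le k\le n$, $A(n,k)$ exists and the comparison morphism $A_n\to A(n,k)$ induced by the faces $\partial_i$, $i\neq k$, is in $\mathcal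 E$. A (quasi-)simplicial object is $\mathcal E$-Kan if its underlying semi-simplicial object is. **Theorem.** Suppose that every nonempty finite sequence of parallel morphisms in $\mathcal A$ has a simplicial kernel and that $\mathcal E$ satisfies (E1)–(E4). Then the following are equivalent: 1. $(\mathcal A,\mathcal E)$ satisfies (E5); 2. every quasi-simplicial object in $\mathcal A$ is $\mathcal E$-Kan; 3. every simplicial object in $\mathcal A$ is $\mathcal E$-Kan. -/

import Mathlib

open CategoryTheory

universe v u

namespace RelMaltsev

/-- The axioms on a class of morphisms ("extensions") that are assumed throughout. -/
structure IsExtensionClass {A : Type u} [Category.{v} A] (E : MorphismProperty A) : Prop where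
  /-- every isomorphism is in the class -/
  of_isIso : ∀ {X Y : A} (f : X ⟶ Y), IsIso f → E f
  /-- a morphism of the class has a pullback along every morphism with the same codomain -/
  exists_pullback : ∀ {X Y Z : A} (f : X ⟶ Z) (g : Y ⟶ Z), E g →
    ∃ (P : A) (p : P ⟶ X) (q : P ⟶ Y), IsPullback p q f g
  /-- pullbacks of morphisms of the class are in the class -/
  of_pullback : ∀ {P X Y Z : A} {p : P ⟶ X} {q : P ⟶ Y} {f : X ⟶ Z} {g : Y ⟶ Z},
    IsPullback p q f g → E g → E p
  /-- the class is closed under composition -/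
  comp : ∀ {X Y Z : A} (f : X ⟶ Y) (g : Y ⟶ Z), E f → E g → E (f ≫ g)
  /-- right cancellation -/
  cancel : ∀ {X Y Z : A} (f : X ⟶ Y) (g : Y ⟶ Z), E (f ≫ g) → E g

/-- The square
```
A₁ -f₁-> B₁
|a       |b
A₀ -f₀-> B₀
```
is a double extension: it commutes, its sides are in `E`, and so are the projections of the
pullback of `f₀` and `b` and the comparison morphism from `A₁` to that pullback. -/
def IsDoubleExtension {A : Type u} [Category.{v} A] (E : MorphismProperty A)
    {A₁ B₁ A₀ B₀ : A} (f₁ : A₁ ⟶ B₁) (a : A₁ ⟶ A₀) (b : B₁ ⟶ B₀) (f₀ : A₀ ⟶ B₀) : Prop :=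
  CommSq f₁ a b f₀ ∧ E f₁ ∧ E a ∧ E b ∧ E f₀ ∧
    ∃ (P : A) (p : P ⟶ A₀) (q : P ⟶ B₁) (c : A₁ ⟶ P),
      IsPullback p q f₀ b ∧ c ≫ p = a ∧ c ≫ q = f₁ ∧ E p ∧ E q ∧ E c

/-- The relative Mal'tsev axiom: every split epimorphism `(f₁, f₀) : a ⟶ b` of extensions
(split by a morphism of arrows `(s₁, s₀) : b ⟶ a`) is a double extension. -/
def MaltsevAxiom {A : Type u} [Category.{v} A] (E : MorphismProperty A) : Prop :=
  ∀ {A₁ B₁ A₀ B₀ : A} (f₁ : A₁ ⟶ B₁) (a : A₁ ⟶ A₀) (b : B₁ ⟶ B₀) (f₀ : A₀ ⟶ B₀)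
    (s₁ : B₁ ⟶ A₁) (s₀ : B₀ ⟶ A₀),
    E a → E b → CommSq f₁ a b f₀ → CommSq s₁ b a s₀ → s₁ ≫ f₁ = 𝟙 B₁ → s₀ ≫ f₀ = 𝟙 B₀ →
    IsDoubleExtension E f₁ a b f₀

/-- `k₀, …, kₙ₊₁ : K ⟶ X` is a simplicial kernel of `f₀, …, fₙ : X ⟶ Y`: it is universal among
the sequences with `fᵢ ∘ kⱼ = fⱼ₋₁ ∘ kᵢ` for `i < j` (below, the pair `i < j` is written
as `i.castSucc < j.succ` with `i ≤ j`). -/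
def IsSimplicialKernel {A : Type u} [Category.{v} A] {X Y : A} {n : ℕ}
    (f : Fin (n + 1) → (X ⟶ Y)) {K : A} (k : Fin (n + 2) → (K ⟶ X)) : Prop :=
  (∀ i j : Fin (n + 1), i ≤ j → k j.succ ≫ f i = k i.castSucc ≫ f j) ∧
    ∀ (Z : A) (z : Fin (n + 2) → (Z ⟶ X)),
      (∀ i j : Fin (n + 1), i ≤ j → z j.succ ≫ f i = z i.castSucc ≫ f j) →
      ∃! u : Z ⟶ K, ∀ i, u ≫ k i = z i

/-- The category has simplicial kernels of all nonempty finite sequences of parallel morphisms. -/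
def HasSimplicialKernels (A : Type u) [Category.{v} A] : Prop :=
  ∀ {X Y : A} {n : ℕ} (f : Fin (n + 1) → (X ⟶ Y)),
    ∃ (K : A) (k : Fin (n + 2) → (K ⟶ X)), IsSimplicialKernel f k

/-- Semi-simplicial objects (without augmentation): `face n i` is `∂ᵢ : Aₙ₊₁ ⟶ Aₙ`, and
`∂ᵢ ∘ ∂ⱼ = ∂ⱼ₋₁ ∘ ∂ᵢ` for `i < j`. -/
structure SemiSimplicial (A : Type u) [Category.{v} A] where
  obj : ℕ → A
  face : ∀ n : ℕ, Fin (n + 2) → (obj (n + 1) ⟶ obj n)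
  face_face : ∀ (n : ℕ) (i j : Fin (n + 2)), i ≤ j →
    face (n + 1) j.succ ≫ face n i = face (n + 1) i.castSucc ≫ face n j

/-- Quasi-simplicial objects (without augmentation): semi-simplicial objects with degeneracies
`deg n i`, i.e. `σᵢ : Aₙ ⟶ Aₙ₊₁`, satisfying the simplicial identities between
faces and degeneracies, but not necessarily those among the degeneracies. -/
structure QuasiSimplicial (A : Type u) [Category.{v} A] extends SemiSimplicial A where
  deg : ∀ n : ℕ, Fin (n + 1) → (obj n ⟶ obj (n + 1))
  /-- `∂ᵢ ∘ σⱼ = σⱼ₋₁ ∘ ∂ᵢ` for `i < j` -/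
  deg_face_of_lt : ∀ (n : ℕ) (i : Fin (n + 2)) (j : Fin (n + 1)), i ≤ j.castSucc →
    deg (n + 1) j.succ ≫ face (n + 1) i.castSucc = face n i ≫ deg n j
  /-- `∂ⱼ ∘ σⱼ = 1` -/
  deg_face_self : ∀ (n : ℕ) (j : Fin (n + 1)), deg n j ≫ face n j.castSucc = 𝟙 (obj n)
  /-- `∂ⱼ₊₁ ∘ σⱼ = 1` -/
  deg_face_succ : ∀ (n : ℕ) (j : Fin (n + 1)), deg n j ≫ face n j.succ = 𝟙 (obj n)
  /-- `∂ᵢ ∘ σⱼ = σⱼ ∘ ∂ᵢ₋₁` for `i > j + 1` -/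
  deg_face_of_gt : ∀ (n : ℕ) (i : Fin (n + 2)) (j : Fin (n + 1)), j.castSucc < i →
    deg (n + 1) j.castSucc ≫ face (n + 1) i.succ = face n i ≫ deg n j

/-- The underlying semi-simplicial object of a simplicial object. -/
def SemiSimplicial.ofSimplicial {A : Type u} [Category.{v} A] (X : SimplicialObject A) :
    SemiSimplicial A where
  obj n := X.obj (Opposite.op (SimplexCategory.mk n))
  face _ i := X.δ i
  face_face _ _ _ h := X.δ_comp_δ h

/-- The underlying quasi-simplicial object of a simplicial object. -/
def QuasiSimplicial.ofSimplicial {A : Type u} [Category.{v} A] (X : SimplicialObject A) :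
    QuasiSimplicial A where
  toSemiSimplicial := SemiSimplicial.ofSimplicial X
  deg _ i := X.σ i
  deg_face_of_lt _ _ _ h := X.δ_comp_σ_of_le h
  deg_face_self _ _ := X.δ_comp_σ_self
  deg_face_succ _ _ := X.δ_comp_σ_succ
  deg_face_of_gt _ _ _ h := X.δ_comp_σ_of_gt h

namespace SemiSimplicial

/-- With `n = m + 2`: a family `aᵢ : H ⟶ Aₙ₋₁`, indexed by the `i ∈ {0, …, n}` other than `k`,
with `∂ᵢ ∘ aⱼ = ∂ⱼ₋₁ ∘ aᵢ` for `i < j`, `i ≠ k`, `j ≠ k`. -/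
def IsHorn {A : Type u} [Category.{v} A] (X : SemiSimplicial A) {m : ℕ} (k : Fin (m + 3))
    {H : A} (a : ∀ i : Fin (m + 3), i ≠ k → (H ⟶ X.obj (m + 1))) : Prop :=
  ∀ (i j : Fin (m + 2)), i ≤ j → ∀ (hi : i.castSucc ≠ k) (hj : j.succ ≠ k),
    a j.succ hj ≫ X.face m i = a i.castSucc hi ≫ X.face m j

/-- With `n = m + 2`: the object `H` with the arrows `aᵢ` is the object of `(n, k)`-horns. -/
def IsHornObject {A : Type u} [Category.{v} A] (X : SemiSimplicial A) {m : ℕ} (k : Fin (m + 3))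
    {H : A} (a : ∀ i : Fin (m + 3), i ≠ k → (H ⟶ X.obj (m + 1))) : Prop :=
  X.IsHorn k a ∧
    ∀ (Z : A) (z : ∀ i : Fin (m + 3), i ≠ k → (Z ⟶ X.obj (m + 1))), X.IsHorn k z →
      ∃! u : Z ⟶ H, ∀ i hi, u ≫ a i hi = z i hi

/-- The relative Kan property. For `n = 1` both horn objects are `A₀`, and the comparison morphisms
are `∂₀` and `∂₁`. For `n = m + 2`, every `(n, k)`-horn object exists and
the comparison morphism `c` from `Aₙ` to it, with components `∂ᵢ`, is in `E`. -/
def IsKan {A : Type u} [Category.{v} A] (E : MorphismProperty A) (X : SemiSimplicial A) : Prop :=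
  (∀ i : Fin 2, E (X.face 0 i)) ∧
    ∀ (m : ℕ) (k : Fin (m + 3)),
      ∃ (H : A) (a : ∀ i : Fin (m + 3), i ≠ k → (H ⟶ X.obj (m + 1))),
        X.IsHornObject k a ∧
          ∃ c : X.obj (m + 2) ⟶ H, (∀ i hi, c ≫ a i hi = X.face (m + 1) i) ∧ E c

end SemiSimplicial

end RelMaltsev

namespace RelMaltsev

variable {A : Type u} [Category.{v} A]

/-! From (E5) to Kan, one proves more: for every nonempty proper set of faces, not only for all
faces but one, the partial horns are represented and the simplices map to them by a morphism in `E`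
(`QuasiSimplicial.isPartialKan`). The faces are added one at a time (`isPartialKan_insert`). If `e,
e + 1 ∉ I` and `j` is one of the two, then horns of shape `insert j I` form a pullback of horns of
shape `I` and simplices one dimension lower, over smaller horns. The square formed with the
simplices is split by `σₑ`, so (E5) puts its comparison morphism in `E`. No identity between two
degeneracies is needed, so quasi-simplicial objects suffice.

Conversely, given a split epimorphism `(f₁, f₀) : a ⟶ b`, take the simplicial object with vertices
in `A₁` and edges `x ~ y ~ x'`, where `a` identifies `x, y` and `f₁` identifies `y, x'`. Simplicial
kernels build it coskeletally (`exists_simplicialObject_zigzag`). Filling an inner horn composes two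
edges into one, and the middle of a suitable composite edge is a local preimage for the comparison
morphism to the pullback (`maltsevAxiom_of_isKan`). -/

theorem IsExtensionClass.of_splitEpi {E : MorphismProperty A} (hE : IsExtensionClass E) {X Y : A}
    {f : X ⟶ Y} (s : Y ⟶ X) (h : s ≫ f = 𝟙 Y) : E f :=
  hE.cancel s f (h ▸ hE.of_isIso _ inferInstance)

/-! ### Partial horns -/

namespace SemiSimplicial

/-- The faces, indexed by natural numbers (with irrelevant values out of range). -/
def natFace (X : SemiSimplicial A) (n i : ℕ) : X.obj (n + 1) ⟶ X.obj n :=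
  X.face n (Fin.ofNat (n + 2) i)

theorem natFace_eq (X : SemiSimplicial A) {n i : ℕ} (h : i < n + 2) :
    X.natFace n i = X.face n ⟨i, h⟩ := by
  unfold natFace
  congr 1
  ext
  simp [Nat.mod_eq_of_lt h]

theorem natFace_natFace (X : SemiSimplicial A) {n i j : ℕ} (hij : i ≤ j) (hj : j ≤ n + 1) :
    X.natFace (n + 1) (j + 1) ≫ X.natFace n i = X.natFace (n + 1) i ≫ X.natFace n j := by
  rw [X.natFace_eq (by omega : j + 1 < n + 1 + 2), X.natFace_eq (by omega : i < n + 2),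
    X.natFace_eq (by omega : i < n + 1 + 2), X.natFace_eq (by omega : j < n + 2)]
  exact X.face_face n ⟨i, by omega⟩ ⟨j, by omega⟩ hij

/-- A family `z i : Z ⟶ X.obj N` whose members with `i ∈ I` are the corresponding faces of a
potential simplex of dimension `N + 1`. Its other members are irrelevant. -/
def IsPartialHorn (X : SemiSimplicial A) (I : Finset ℕ) :
    ∀ {N : ℕ} {Z : A}, (ℕ → (Z ⟶ X.obj N)) → Prop
  | 0, _, _ => True
  | N + 1, _, z => ∀ i j, i ≤ j → i ∈ I → j + 1 ∈ I →
      z (j + 1) ≫ X.natFace N i = z i ≫ X.natFace N j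

/-- The object of partial horns of shape `I` exists, and the simplices of dimension `N + 1`
map to it by a morphism of the class. -/
def IsPartialKan (E : MorphismProperty A) (X : SemiSimplicial A) (N : ℕ) (I : Finset ℕ) : Prop :=
  ∃ (H : A) (a : ℕ → (H ⟶ X.obj N)), X.IsPartialHorn I a ∧
    (∀ (Z : A) (z : ℕ → (Z ⟶ X.obj N)), X.IsPartialHorn I z →
      ∃! u : Z ⟶ H, ∀ i ∈ I, u ≫ a i = z i) ∧
    ∃ c : X.obj (N + 1) ⟶ H, (∀ i ∈ I, c ≫ a i = X.natFace N i) ∧ E c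

/-- A single face is subject to no compatibility condition, so the horn object is `X.obj N` itself.
This starts the induction on shapes. -/
theorem isPartialKan_singleton {E : MorphismProperty A} (X : SemiSimplicial A) (N j : ℕ)
    (h : E (X.natFace N j)) : X.IsPartialKan E N {j} := by
  refine ⟨X.obj N, fun _ => 𝟙 _, ?_, fun Z z _ => ⟨z j, by simp, fun u hu => ?_⟩,
    X.natFace N j, by simp, h⟩
  · cases N with
    | zero => trivial
    | succ N =>
      intro i k hik hi hk
      simp only [Finset.mem_singleton] at hi hk
      omega
  · simpa using hu

theorem isKan_of_isPartialKan {E : MorphismProperty A} (X : SemiSimplicial A)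
    (h₀ : ∀ i, i < 2 → E (X.natFace 0 i))
    (h : ∀ m k, k < m + 3 → X.IsPartialKan E (m + 1) ((Finset.range (m + 3)).erase k)) :
    X.IsKan E := by
  refine ⟨fun i => X.natFace_eq i.2 ▸ h₀ i i.2, fun m k => ?_⟩
  have key : ∀ i : Fin (m + 3), i ≠ k ↔ (i : ℕ) ∈ (Finset.range (m + 3)).erase (k : ℕ) := by
    intro i
    simp [Fin.ext_iff]
  obtain ⟨H, a, ha, hu, c, hc, hEc⟩ := h m k k.2
  have nf : ∀ i : Fin (m + 2), X.natFace m i = X.face m i := fun i => X.natFace_eq i.2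
  refine ⟨H, fun i _ => a i, ⟨fun i j hij hi hj => ?_, fun Z z hz => ?_⟩, c, fun i hi => ?_, hEc⟩
  · have := ha i j hij ((key i.castSucc).1 hi) ((key j.succ).1 hj)
    rwa [nf, nf] at this
  · obtain ⟨i₀, hi₀⟩ : ∃ i₀ : Fin (m + 3), i₀ ≠ k := exists_ne k
    obtain ⟨y, hy⟩ : ∃ y : ℕ → (Z ⟶ X.obj (m + 1)),
        ∀ (i : Fin (m + 3)) (hi : i ≠ k), y i = z i hi := by
      refine ⟨fun i => if h : ∃ l : Fin (m + 3), (l : ℕ) = i ∧ l ≠ k then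
        z h.choose h.choose_spec.2 else z i₀ hi₀, fun i hi => ?_⟩
      have h : ∃ l : Fin (m + 3), (l : ℕ) = i ∧ l ≠ k := ⟨i, rfl, hi⟩
      refine (dif_pos h).trans ?_
      have : h.choose = i := Fin.ext h.choose_spec.1
      congr 1
    have hy' : X.IsPartialHorn ((Finset.range (m + 3)).erase (k : ℕ)) y := by
      intro i j hij hi hj
      have hj₁ : j + 1 < m + 3 := Finset.mem_range.1 (Finset.mem_of_mem_erase hj)
      have hi' := (key (Fin.castSucc ⟨i, by omega⟩)).2 hi
      have hj' := (key (Fin.succ ⟨j, by omega⟩)).2 hj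
      have := hz ⟨i, by omega⟩ ⟨j, by omega⟩ hij hi' hj'
      rw [← hy, ← hy, ← nf, ← nf] at this
      exact this
    obtain ⟨u, hu₁, hu₂⟩ := hu Z y hy'
    refine ⟨u, fun i hi => (hu₁ i ((key i).1 hi)).trans (hy i hi), fun w hw => hu₂ w ?_⟩
    intro i hi
    have hi₁ : i < m + 3 := Finset.mem_range.1 (Finset.mem_of_mem_erase hi)
    have hi' := (key ⟨i, hi₁⟩).2 hi
    exact (hw _ hi').trans (hy _ hi').symm
  · rw [hc i ((key i).1 hi)]
    exact X.natFace_eq i.2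

end SemiSimplicial

/-! ### From the Mal'tsev axiom to the Kan property -/

namespace QuasiSimplicial

/-- The degeneracies, indexed by natural numbers (with irrelevant values out of range). -/
def natDeg (X : QuasiSimplicial A) (n i : ℕ) : X.obj n ⟶ X.obj (n + 1) :=
  X.deg n (Fin.ofNat (n + 1) i)

theorem natDeg_eq (X : QuasiSimplicial A) {n i : ℕ} (h : i < n + 1) :
    X.natDeg n i = X.deg n ⟨i, h⟩ := by
  unfold natDeg
  congr 1
  ext
  simp [Nat.mod_eq_of_lt h]

theorem natDeg_natFace_of_le (X : QuasiSimplicial A) {n i j : ℕ} (hij : i ≤ j) (hj : j ≤ n) :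
    X.natDeg (n + 1) (j + 1) ≫ X.natFace (n + 1) i = X.natFace n i ≫ X.natDeg n j := by
  rw [X.natDeg_eq (by omega : j + 1 < n + 1 + 1), X.natFace_eq (by omega : i < n + 1 + 2),
    X.natFace_eq (by omega : i < n + 2), X.natDeg_eq (by omega : j < n + 1)]
  exact X.deg_face_of_lt n ⟨i, by omega⟩ ⟨j, by omega⟩ hij

theorem natDeg_natFace_of_lt (X : QuasiSimplicial A) {n i j : ℕ} (hij : j < i) (hi : i ≤ n + 1) :
    X.natDeg (n + 1) j ≫ X.natFace (n + 1) (i + 1) = X.natFace n i ≫ X.natDeg n j := by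
  rw [X.natDeg_eq (by omega : j < n + 1 + 1), X.natFace_eq (by omega : i + 1 < n + 1 + 2),
    X.natFace_eq (by omega : i < n + 2), X.natDeg_eq (by omega : j < n + 1)]
  exact X.deg_face_of_gt n ⟨i, by omega⟩ ⟨j, by omega⟩ hij

theorem natDeg_natFace_eq_id (X : QuasiSimplicial A) {n i j : ℕ} (hij : i = j ∨ i = j + 1)
    (hj : j ≤ n) : X.natDeg n j ≫ X.natFace n i = 𝟙 _ := by
  rw [X.natDeg_eq (by omega : j < n + 1), X.natFace_eq (by omega : i < n + 2)]
  obtain rfl | rfl := hij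
  · exact X.deg_face_self n ⟨i, by omega⟩
  · exact X.deg_face_succ n ⟨j, by omega⟩

theorem natFace_mem {E : MorphismProperty A} (hE : IsExtensionClass E) (X : QuasiSimplicial A)
    {n i : ℕ} (hi : i ≤ n + 1) : E (X.natFace n i) := by
  by_cases h : i ≤ n
  · exact hE.of_splitEpi (X.natDeg n i) (X.natDeg_natFace_eq_id (Or.inl rfl) h)
  · exact hE.of_splitEpi (X.natDeg n n) (X.natDeg_natFace_eq_id (Or.inr (by omega)) le_rfl)

/-- The shape of the horn of faces of `∂ⱼ x`, `j ∈ {e, e + 1}`, determined by the faces `∂ᵢ x`,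
`i ∈ I`. -/
def collapse (M e : ℕ) (I : Finset ℕ) : Finset ℕ :=
  (Finset.range (M + 2)).filter fun i => (i < e ∧ i ∈ I) ∨ (e < i ∧ i + 1 ∈ I)

theorem mem_collapse {M e i : ℕ} {I : Finset ℕ} :
    i ∈ collapse M e I ↔ i < M + 2 ∧ ((i < e ∧ i ∈ I) ∨ (e < i ∧ i + 1 ∈ I)) := by
  simp [collapse]

/-- For `i < e` one has `∂ᵢ∂ⱼ = ∂ⱼ₋₁∂ᵢ`, and for `i > e` one has `∂ᵢ∂ⱼ = ∂ⱼ∂ᵢ₊₁`, whichever of the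
two values `j` takes. Position `e` is omitted because it relates the faces `e` and `e + 1` to each
other. -/
theorem isPartialHorn_face (X : QuasiSimplicial A) {M e j : ℕ} {I : Finset ℕ}
    (hj : j = e ∨ j = e + 1) (he : e ≤ M + 1) (hI : ∀ i ∈ I, i < M + 3)
    {Z : A} {z : ℕ → (Z ⟶ X.obj (M + 1))} (hz : X.IsPartialHorn I z) :
    X.IsPartialHorn (collapse M e I)
      (fun i => if i < e then z i ≫ X.natFace M (j - 1) else z (i + 1) ≫ X.natFace M j) := by
  cases M with
  | zero => trivial
  | succ M =>
    intro i l hil hi hl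
    rw [mem_collapse] at hi hl
    have hf := fun i j : ℕ => X.natFace_natFace (n := M) (i := i) (j := j)
    by_cases h₁ : l + 1 < e
    · have := hz i l hil (by grind) (by grind)
      obtain ⟨j, rfl⟩ : ∃ k, j = k + 2 := ⟨j - 2, by omega⟩
      have h₂ : i < e := by omega
      simp only [h₁, h₂, if_true, Category.assoc]
      rw [show j + 2 - 1 = j + 1 by omega, hf i j (by omega) (by omega), reassoc_of% this,
        hf l j (by omega) (by omega)]
    · by_cases h₂ : i < e
      · have := hz i (l + 1) (by omega) (by grind) (by grind)
        obtain ⟨j, rfl⟩ : ∃ k, j = k + 1 := ⟨j - 1, by omega⟩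
        simp only [h₁, h₂, if_true, if_false, Category.assoc]
        rw [show j + 1 - 1 = j by omega, hf i j (by omega) (by omega), reassoc_of% this,
          ← hf j l (by omega) (by omega)]
      · have := hz (i + 1) (l + 1) (by omega) (by grind) (by grind)
        simp only [h₁, h₂, if_false, Category.assoc]
        rw [← hf j i (by omega) (by omega), reassoc_of% this, ← hf j l (by omega) (by omega)]

/-- Away from `e` and `e + 1`, every face of `σₑ x` is a degeneracy of a face of `x`; hence `σₑ`
acts on horns. -/
theorem isPartialHorn_deg (X : QuasiSimplicial A) {M e : ℕ} {I : Finset ℕ}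
    (he : e ≤ M + 1) (he₀ : e ∉ I) (he₁ : e + 1 ∉ I) (hI : ∀ i ∈ I, i < M + 3)
    {Z : A} {z : ℕ → (Z ⟶ X.obj M)} (hz : X.IsPartialHorn (collapse M e I) z) :
    X.IsPartialHorn I
      (fun i => if i < e then z i ≫ X.natDeg M (e - 1) else z (i - 1) ≫ X.natDeg M e) := by
  intro i l hil hi hl
  have := hI _ hl
  have hil' : i ≠ e ∧ i ≠ e + 1 ∧ l + 1 ≠ e ∧ l ≠ e := by grind
  cases M with
  -- Of the three indices, `e` and `e + 1` are excluded, so `I` has no two distinct elements.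
  | zero => omega
  | succ M =>
    have hle := fun {i j : ℕ} => X.natDeg_natFace_of_le (n := M) (i := i) (j := j)
    have hlt := fun {i j : ℕ} => X.natDeg_natFace_of_lt (n := M) (i := i) (j := j)
    by_cases h₁ : l + 1 < e
    · have := hz i l hil (by grind [mem_collapse]) (by grind [mem_collapse])
      obtain ⟨e, rfl⟩ : ∃ k, e = k + 2 := ⟨e - 2, by omega⟩
      have h₂ : i < e + 2 := by omega
      simp only [h₁, h₂, if_true, Category.assoc]
      rw [show e + 2 - 1 = e + 1 by omega, hle (by omega) (by omega), hle (by omega) (by omega),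
        reassoc_of% this]
    · obtain ⟨l, rfl⟩ : ∃ k, l = k + 1 := ⟨l - 1, by omega⟩
      by_cases h₂ : i < e
      · have := hz i l (by omega) (by grind [mem_collapse]) (by grind [mem_collapse])
        obtain ⟨e, rfl⟩ : ∃ k, e = k + 1 := ⟨e - 1, by omega⟩
        simp only [h₁, h₂, if_true, if_false, Category.assoc]
        rw [show e + 1 - 1 = e by omega, show l + 1 + 1 - 1 = l + 1 by omega,
          hle (by omega) (by omega), hlt (by omega) (by omega), reassoc_of% this]
      · obtain ⟨i, rfl⟩ : ∃ k, i = k + 1 := ⟨i - 1, by omega⟩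
        have := hz i l (by omega) (by grind [mem_collapse]) (by grind [mem_collapse])
        simp only [h₁, h₂, if_false, Category.assoc]
        rw [show i + 1 - 1 = i by omega, show l + 1 + 1 - 1 = l + 1 by omega,
          hlt (by omega) (by omega), hlt (by omega) (by omega), reassoc_of% this]

/-- Taking the `j`-th face induces `t` on horns, and `σₑ` induces a section `s` of it. A face `z j`
fits a horn of shape `I` exactly when both have the same image among the smaller horns, so the
required horn object is the pullback in (E5). -/
theorem isPartialKan_insert {E : MorphismProperty A} (hM : MaltsevAxiom E)
    (X : QuasiSimplicial A) {M e j : ℕ} {I : Finset ℕ}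
    (hj : j = e ∨ j = e + 1) (he : e ≤ M + 1) (he₀ : e ∉ I) (he₁ : e + 1 ∉ I)
    (hI : ∀ i ∈ I, i < M + 3) (h₁ : X.IsPartialKan E (M + 1) I)
    (h₂ : X.IsPartialKan E M (collapse M e I)) :
    X.IsPartialKan E (M + 1) (insert j I) := by
  obtain ⟨H, a, ha, hu, c, hc, hEc⟩ := h₁
  obtain ⟨H', a', ha', hu', c', hc', hEc'⟩ := h₂
  have hext : ∀ {Z : A} (u w : Z ⟶ H), X.IsPartialHorn I (fun i => u ≫ a i) →
      (∀ i ∈ I, u ≫ a i = w ≫ a i) → u = w := fun u w h h' =>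
    (hu _ _ h).unique (fun _ _ => rfl) fun i hi => (h' i hi).symm
  have hcomp : ∀ {Z : A} (u : Z ⟶ H), X.IsPartialHorn I (fun i => u ≫ a i) := by
    intro Z u i l hil hi hl
    simp only [Category.assoc, ha i l hil hi hl]
  have hcomp' : ∀ {Z : A} (u : Z ⟶ H'), X.IsPartialHorn (collapse M e I) (fun i => u ≫ a' i) := by
    intro Z u
    cases M with
    | zero => trivial
    | succ M =>
      intro i l hil hi hl
      simp only [Category.assoc, ha' i l hil hi hl]
  have hext' : ∀ {Z : A} (u w : Z ⟶ H'),
      (∀ i ∈ collapse M e I, u ≫ a' i = w ≫ a' i) → u = w := fun u w h' =>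
    (hu' _ _ (hcomp' u)).unique (fun _ _ => rfl) fun i hi => (h' i hi).symm
  obtain ⟨t, ht, -⟩ := hu' _ _ (X.isPartialHorn_face hj he hI ha)
  obtain ⟨s, hs, -⟩ := hu _ _ (X.isPartialHorn_deg he he₀ he₁ hI ha')
  have hjI : j ∉ I := by rcases hj with rfl | rfl <;> assumption
  have ht₁ : ∀ i ∈ I, i < e → t ≫ a' i = a i ≫ X.natFace M (j - 1) := by
    intro i hi hie
    rw [ht i (by grind [mem_collapse]), if_pos hie]
  have ht₂ : ∀ i, i + 1 ∈ I → e < i → t ≫ a' i = a (i + 1) ≫ X.natFace M j := by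
    intro i hi hie
    rw [ht i (by grind [mem_collapse]), if_neg (by omega)]
  have hs₁ : ∀ i ∈ I, i < e → s ≫ a i = a' i ≫ X.natDeg M (e - 1) := by
    intro i hi hie
    rw [hs i hi, if_pos hie]
  have hs₂ : ∀ i, i + 1 ∈ I → e < i → s ≫ a (i + 1) = a' i ≫ X.natDeg M e := by
    intro i hi hie
    rw [hs _ hi, if_neg (by omega), Nat.add_sub_cancel]
  have hcases : ∀ i ∈ I, i < e ∨ ∃ k, i = k + 1 ∧ e < k := by
    intro i hi
    have : i ≠ e ∧ i ≠ e + 1 := by grind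
    by_cases h : i < e
    · exact Or.inl h
    · exact Or.inr ⟨i - 1, by omega, by omega⟩
  have hne : ∀ i ∈ I, i ≠ j := by rintro i hi rfl; exact hjI hi
  -- (E5) for `(∂ⱼ, t) : c ⟶ c'`, split by `(σₑ, s)`; the four proofs supplied are the two squares
  -- and the two section identities.
  obtain ⟨-, -, -, -, -, P, p, q, r, hP, hrp, hrq, -, -, hEr⟩ :=
    hM (X.natFace (M + 1) j) c c' t (X.natDeg (M + 1) e) s hEc hEc'
      ⟨by
        refine hext' _ _ fun i hi => ?_
        obtain ⟨hi₀, ⟨hi₁, hi₂⟩ | ⟨hi₁, hi₂⟩⟩ := mem_collapse.1 hi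
        · obtain ⟨j, rfl⟩ : ∃ k, j = k + 1 := ⟨j - 1, by omega⟩
          rw [Category.assoc, Category.assoc, hc' i hi, ht₁ i hi₂ hi₁, reassoc_of% (hc i hi₂),
            Nat.add_sub_cancel, X.natFace_natFace (by omega) (by omega)]
        · rw [Category.assoc, Category.assoc, hc' i hi, ht₂ i hi₂ hi₁, reassoc_of% (hc _ hi₂),
            X.natFace_natFace (by omega) (by omega)]⟩
      ⟨by
        refine hext _ _ (hcomp _) fun i hi => ?_
        have := hI i hi
        obtain hi₁ | ⟨i, rfl, hi₁⟩ := hcases i hi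
        · have hi' : i ∈ collapse M e I := by grind [mem_collapse]
          obtain ⟨e, rfl⟩ : ∃ k, e = k + 1 := ⟨e - 1, by omega⟩
          rw [Category.assoc, Category.assoc, hc i hi, hs₁ i hi hi₁, reassoc_of% (hc' i hi'),
            Nat.add_sub_cancel, X.natDeg_natFace_of_le (by omega) (by omega)]
        · have hi' : i ∈ collapse M e I := by grind [mem_collapse]
          rw [Category.assoc, Category.assoc, hc _ hi, hs₂ i hi hi₁, reassoc_of% (hc' i hi'),
            X.natDeg_natFace_of_lt (by omega) (by omega)]⟩
      (X.natDeg_natFace_eq_id hj (by omega))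
      (by
        refine hext' _ _ fun i hi => ?_
        obtain ⟨hi₀, ⟨hi₁, hi₂⟩ | ⟨hi₁, hi₂⟩⟩ := mem_collapse.1 hi
        · rw [Category.assoc, ht₁ i hi₂ hi₁, reassoc_of% (hs₁ i hi₂ hi₁),
            X.natDeg_natFace_eq_id (by omega) (by omega), Category.comp_id, Category.id_comp]
        · rw [Category.assoc, ht₂ i hi₂ hi₁, reassoc_of% (hs₂ i hi₂ hi₁),
            X.natDeg_natFace_eq_id (by omega) (by omega), Category.comp_id, Category.id_comp])
  refine ⟨P, fun i => if i = j then q else p ≫ a i, ?_, fun Z z hz => ?_, r, ?_, hEr⟩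
  · intro i l hil hi hl
    have hw := hP.w
    beta_reduce
    rw [Finset.mem_insert] at hi hl
    rcases hi with rfl | hi <;> rcases hl with hl | hl
    · omega
    · have hI' := hI _ hl
      have hl₁ : e < l := by
        rcases hcases _ hl with h | ⟨k, hk, hk'⟩ <;> omega
      have hl' : l ∈ collapse M e I := by grind [mem_collapse]
      rw [if_neg (hne _ hl), if_pos rfl, Category.assoc, ← ht₂ l hl hl₁, reassoc_of% hw,
        hc' l hl']
    · have hi₁ : i < e := by
        rcases hcases _ hi with h | ⟨k, hk, hk'⟩ <;> omega
      have hi' : i ∈ collapse M e I := by grind [mem_collapse]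
      have := ht₁ i hi hi₁
      rw [show j - 1 = l by omega] at this
      rw [if_pos hl, if_neg (hne _ hi), Category.assoc, ← this, reassoc_of% hw, hc' i hi']
    · rw [if_neg (hne _ hl), if_neg (hne _ hi)]
      simp only [Category.assoc, ha i l hil hi hl]
  · have hzI : X.IsPartialHorn I z := fun i l hil hi hl =>
      hz i l hil (Finset.mem_insert_of_mem hi) (Finset.mem_insert_of_mem hl)
    obtain ⟨u, huz, -⟩ := hu Z z hzI
    have hut : u ≫ t = z j ≫ c' := by
      refine hext' _ _ fun i hi => ?_
      obtain ⟨hi₀, ⟨hi₁, hi₂⟩ | ⟨hi₁, hi₂⟩⟩ := mem_collapse.1 hi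
      · obtain ⟨j, rfl⟩ : ∃ k, j = k + 1 := ⟨j - 1, by omega⟩
        rw [Category.assoc, Category.assoc, hc' i hi, ht₁ i hi₂ hi₁, reassoc_of% (huz i hi₂),
          Nat.add_sub_cancel,
          hz i j (by omega) (Finset.mem_insert_of_mem hi₂) (Finset.mem_insert_self _ _)]
      · rw [Category.assoc, Category.assoc, hc' i hi, ht₂ i hi₂ hi₁, reassoc_of% (huz _ hi₂),
          hz j i (by omega) (Finset.mem_insert_self _ _) (Finset.mem_insert_of_mem hi₂)]
    refine ⟨hP.lift u (z j) hut, fun i hi => ?_, fun w hw => ?_⟩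
    · rcases Finset.mem_insert.1 hi with rfl | hi
      · simp
      · simp [hne i hi, huz i hi]
    · apply hP.hom_ext
      · rw [hP.lift_fst]
        refine hext _ _ (hcomp _) fun i hi => ?_
        have := hw i (Finset.mem_insert_of_mem hi)
        beta_reduce at this
        rw [if_neg (hne i hi)] at this
        rw [Category.assoc, this, huz i hi]
      · have := hw j (Finset.mem_insert_self _ _)
        beta_reduce at this
        rw [if_pos rfl] at this
        rw [hP.lift_snd, this]
  · intro i hi
    rcases Finset.mem_insert.1 hi with rfl | hi
    · simp [hrq]
    · simp [hne i hi, reassoc_of% hrp, hc i hi]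

/-- Walking from an element of `J` towards `k`, one must leave `J` at some step. -/
theorem exists_mem_adjacent {J : Finset ℕ} {k : ℕ} (hJ : J.Nonempty) (hk : k ∉ J) :
    (∃ e, e + 1 ≤ k ∧ e ∈ J ∧ e + 1 ∉ J) ∨ ∃ e, e ∉ J ∧ e + 1 ∈ J := by
  by_contra! h
  obtain ⟨h₁, h₂⟩ := h
  obtain ⟨x, hx⟩ := hJ
  rcases lt_or_ge x k with hxk | hxk
  · have : ∀ d, x + d ≤ k → x + d ∈ J := by
      intro d
      induction d with
      | zero => simpa using fun _ => hx
      | succ d ih => exact fun hd => h₁ (x + d) (by omega) (ih (by omega))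
    exact hk (by simpa [Nat.add_sub_cancel' hxk.le] using this (k - x) (by omega))
  · have : ∀ d, d ≤ x - k → x - d ∈ J := by
      intro d
      induction d with
      | zero => simpa using hx
      | succ d ih =>
        intro hd
        by_contra hn
        refine h₂ (x - (d + 1)) hn ?_
        rw [show x - (d + 1) + 1 = x - d by omega]
        exact ih (by omega)
    exact hk (by simpa [Nat.sub_sub_self hxk] using this (x - k) le_rfl)

/-- Induction on the dimension and, within it, on the shape: remove a face next to a missing one,
then restore it by `isPartialKan_insert`. -/
theorem isPartialKan {E : MorphismProperty A} (hE : IsExtensionClass E) (hM : MaltsevAxiom E)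
    (X : QuasiSimplicial A) (N : ℕ) : ∀ (J : Finset ℕ), J.Nonempty → (∀ i ∈ J, i < N + 2) →
      ∀ k, k < N + 2 → k ∉ J → X.IsPartialKan E N J := by
  induction N with
  | zero =>
    intro J hJ hb k hk hkJ
    obtain ⟨x, hx⟩ := hJ
    have : J = {x} := by
      refine Finset.eq_singleton_iff_unique_mem.2 ⟨hx, fun y hy => ?_⟩
      have := hb x hx
      have := hb y hy
      have : k ≠ x ∧ k ≠ y := by grind
      omega
    rw [this]
    exact X.isPartialKan_singleton _ _ (X.natFace_mem hE (by have := hb x hx; omega))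
  | succ M ih =>
    intro J
    induction J using Finset.strongInduction with
    | H J ihJ =>
      intro hJ hb k hk hkJ
      obtain ⟨e, j, hj, he, hjJ, he₀, he₁⟩ : ∃ e j, (j = e ∨ j = e + 1) ∧ e ≤ M + 1 ∧ j ∈ J ∧
          e ∉ J.erase j ∧ e + 1 ∉ J.erase j := by
        rcases exists_mem_adjacent hJ hkJ with ⟨e, h₁, h₂, h₃⟩ | ⟨e, h₁, h₂⟩
        · exact ⟨e, e, Or.inl rfl, by omega, h₂, by simp, by simp [h₃]⟩
        · have := hb _ h₂
          exact ⟨e, e + 1, Or.inr rfl, by omega, h₂, by simp [h₁], by simp⟩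
      have hbI : ∀ i ∈ J.erase j, i < M + 3 := fun i hi => hb i (Finset.mem_of_mem_erase hi)
      rcases (J.erase j).eq_empty_or_nonempty with hI | ⟨x, hx⟩
      · rw [← Finset.insert_erase hjJ, hI]
        exact X.isPartialKan_singleton _ _ (X.natFace_mem hE (by have := hb j hjJ; omega))
      · rw [← Finset.insert_erase hjJ]
        -- The collapsed shape is again proper, since it omits `e`; its nonemptiness is left to the
        -- end.
        refine X.isPartialKan_insert hM hj he he₀ he₁ hbI
          (ihJ _ (Finset.erase_ssubset hjJ) ⟨x, hx⟩ hbI k hk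
            fun h => hkJ (Finset.mem_of_mem_erase h))
          (ih _ ?_ (fun i hi => (mem_collapse.1 hi).1) e (by omega) (by simp [mem_collapse]))
        have := hbI x hx
        have hne : x ≠ e ∧ x ≠ e + 1 := by grind
        by_cases hxe : x < e
        · exact ⟨x, mem_collapse.2 ⟨by omega, Or.inl ⟨hxe, hx⟩⟩⟩
        · refine ⟨x - 1, mem_collapse.2 ⟨by omega, Or.inr ⟨by omega, ?_⟩⟩⟩
          rwa [show x - 1 + 1 = x by omega]

theorem isKan_of_maltsevAxiom {E : MorphismProperty A} (hE : IsExtensionClass E)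
    (hM : MaltsevAxiom E) (X : QuasiSimplicial A) : X.toSemiSimplicial.IsKan E := by
  refine X.isKan_of_isPartialKan (fun i hi => X.natFace_mem hE (by omega)) fun m k hk =>
    X.isPartialKan hE hM _ _ ?_ (fun i hi => ?_) k hk (by simp)
  · by_cases h : k = 0
    · exact ⟨1, by simp [h]⟩
    · exact ⟨0, by simp; omega⟩
  · exact Finset.mem_range.1 (Finset.mem_of_mem_erase hi)

end QuasiSimplicial

/-! ### The simplicial object of zigzags -/

variable {X Y Y' : A}

/-- A zigzag family of dimension `n`: vertices `z i i` in `X` and, for `i ≤ j`, an element `z i j`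
identified with `z i i` by `a` and with `z j j` by `f`. -/
def IsZigzag (a : X ⟶ Y) (f : X ⟶ Y') {n : ℕ} {Z : A}
    (z : ∀ i j : Fin (n + 1), i ≤ j → (Z ⟶ X)) : Prop :=
  ∀ i j h, z i j h ≫ a = z i i le_rfl ≫ a ∧ z i j h ≫ f = z j j le_rfl ≫ f

/-- The zigzag family `z` on `K` is universal. -/
def IsUniversalZigzag (a : X ⟶ Y) (f : X ⟶ Y') {n : ℕ} {K : A}
    (z : ∀ i j : Fin (n + 1), i ≤ j → (K ⟶ X)) : Prop :=
  IsZigzag a f z ∧ ∀ (Z : A) (y : ∀ i j : Fin (n + 1), i ≤ j → (Z ⟶ X)), IsZigzag a f y →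
    ∃! u : Z ⟶ K, ∀ i j h, u ≫ z i j h = y i j h

theorem IsZigzag.reindex {a : X ⟶ Y} {f : X ⟶ Y'} {n m : ℕ} {Z : A}
    {z : ∀ i j : Fin (n + 1), i ≤ j → (Z ⟶ X)} (hz : IsZigzag a f z)
    (θ : Fin (m + 1) →o Fin (n + 1)) :
    IsZigzag a f (fun i j h => z (θ i) (θ j) (θ.monotone h)) :=
  fun i j h => hz (θ i) (θ j) (θ.monotone h)

theorem IsZigzag.precomp {a : X ⟶ Y} {f : X ⟶ Y'} {n : ℕ} {Z W : A}
    {z : ∀ i j : Fin (n + 1), i ≤ j → (Z ⟶ X)} (hz : IsZigzag a f z) (w : W ⟶ Z) :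
    IsZigzag a f (fun i j h => w ≫ z i j h) :=
  fun i j h => by simp [hz i j h]

namespace IsUniversalZigzag

variable {a : X ⟶ Y} {f : X ⟶ Y'} {n : ℕ} {K : A} {z : ∀ i j : Fin (n + 1), i ≤ j → (K ⟶ X)}

theorem exists_lift (hz : IsUniversalZigzag a f z) {Z : A}
    {y : ∀ i j : Fin (n + 1), i ≤ j → (Z ⟶ X)} (hy : IsZigzag a f y) :
    ∃ u : Z ⟶ K, ∀ i j h, u ≫ z i j h = y i j h :=
  (hz.2 Z y hy).exists

theorem hom_ext (hz : IsUniversalZigzag a f z) {Z : A} {u w : Z ⟶ K}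
    (h : ∀ i j h, u ≫ z i j h = w ≫ z i j h) : u = w :=
  (hz.2 Z _ (hz.1.precomp w)).unique h fun _ _ _ => rfl

end IsUniversalZigzag

theorem exists_isUniversalZigzag_zero (a : X ⟶ Y) (f : X ⟶ Y') :
    ∃ (K : A) (z : ∀ i j : Fin (0 + 1), i ≤ j → (K ⟶ X)), IsUniversalZigzag a f z := by
  refine ⟨X, fun _ _ _ => 𝟙 X, fun i j h => by simp, fun Z y _ =>
    ⟨y 0 0 le_rfl, fun i j h => ?_, fun u hu => by simpa using hu 0 0 le_rfl⟩⟩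
  obtain rfl : i = 0 := Subsingleton.elim (α := Fin 1) _ _
  obtain rfl : j = 0 := Subsingleton.elim (α := Fin 1) _ _
  simp

theorem isZigzag_one {a : X ⟶ Y} {f : X ⟶ Y'} {Z : A}
    {z : ∀ i j : Fin (1 + 1), i ≤ j → (Z ⟶ X)}
    (h : z 0 1 (by decide) ≫ a = z 0 0 le_rfl ≫ a)
    (h' : z 0 1 (by decide) ≫ f = z 1 1 le_rfl ≫ f) : IsZigzag a f z := by
  intro i j hij
  fin_cases i <;> fin_cases j
  · exact ⟨rfl, rfl⟩
  · exact ⟨h, h'⟩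
  · exact absurd hij (by decide)
  · exact ⟨rfl, rfl⟩

/-- An edge is a chain of two identifications, so two pullbacks suffice: the kernel pair of `a`,
then a pullback along `f`. -/
theorem exists_isUniversalZigzag_one {E : MorphismProperty A} (hE : IsExtensionClass E)
    (a : X ⟶ Y) (f : X ⟶ Y') (ha : E a) (hf : E f) :
    ∃ (K : A) (z : ∀ i j : Fin (1 + 1), i ≤ j → (K ⟶ X)), IsUniversalZigzag a f z := by
  obtain ⟨N, p₁, p₂, hp⟩ := hE.exists_pullback a a ha
  obtain ⟨K, r, s, hr⟩ := hE.exists_pullback (p₂ ≫ f) f hf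
  have hw := hp.w
  have hw' := hr.w
  refine ⟨K, fun i j _ => if j = 0 then r ≫ p₁ else if i = 0 then r ≫ p₂ else s, ?_,
    fun Z y hy => ?_⟩
  · exact isZigzag_one (by simp [hw]) (by simpa using hw')
  · have h₀₁ := hy 0 1 (by simp)
    refine ⟨hr.lift (hp.lift (y 0 0 le_rfl) (y 0 1 (by simp)) h₀₁.1.symm) (y 1 1 le_rfl)
      (by simpa using h₀₁.2), fun i j h => ?_, fun u hu => ?_⟩
    · fin_cases i <;> fin_cases j
      · simp
      · simp
      · exact absurd h (by decide)
      · simp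
    · apply hr.hom_ext
      · apply hp.hom_ext
        · simpa using hu 0 0 le_rfl
        · simpa using hu 0 1 (by simp)
      · simpa using hu 1 1 le_rfl

/-- The coface identity: both sides enumerate the indices other than `i` and `j + 1`. -/
theorem succAbove_comm {n : ℕ} {i j : Fin (n + 2)} (h : i ≤ j) (r : Fin (n + 1)) :
    j.succ.succAbove (i.succAbove r) = i.castSucc.succAbove (j.succAbove r) := by
  simp only [Fin.succAbove, Fin.lt_def, Fin.ext_iff, Fin.le_def] at *
  split_ifs <;> simp_all <;> omega

/-- A family of `n + 3` compatible zigzags of dimension `n + 1` glues to the underlying family of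
a zigzag of dimension `n + 2`. -/
theorem exists_glue {n : ℕ} {K₀ K₁ : A}
    {z₀ : ∀ i j : Fin (n + 1), i ≤ j → (K₀ ⟶ X)} {z₁ : ∀ i j : Fin (n + 2), i ≤ j → (K₁ ⟶ X)}
    {d : Fin (n + 2) → (K₁ ⟶ K₀)}
    (hd : ∀ c i j h, d c ≫ z₀ i j h =
      z₁ (c.succAbove i) (c.succAbove j) ((Fin.strictMono_succAbove c).monotone h))
    {Z : A} {k : Fin (n + 3) → (Z ⟶ K₁)}
    (hk : ∀ i j : Fin (n + 2), i ≤ j → k j.succ ≫ d i = k i.castSucc ≫ d j) :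
    ∃ y : ∀ i j : Fin (n + 3), i ≤ j → (Z ⟶ X), ∀ c i j h,
      k c ≫ z₁ i j h =
        y (c.succAbove i) (c.succAbove j) ((Fin.strictMono_succAbove c).monotone h) := by
  have hlt : ∀ c c' : Fin (n + 3), c < c' → ∀ (p q p' q' : Fin (n + 2)) (h : p ≤ q)
      (h' : p' ≤ q'), c.succAbove p = c'.succAbove p' → c.succAbove q = c'.succAbove q' →
      k c ≫ z₁ p q h = k c' ≫ z₁ p' q' h' := by
    intro c c' hcc p q p' q' h h' hp hq
    obtain ⟨i, rfl⟩ : ∃ i : Fin (n + 2), c = i.castSucc :=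
      ⟨c.castPred (Fin.ne_last_of_lt hcc), by simp⟩
    obtain ⟨j, rfl⟩ : ∃ j : Fin (n + 2), c' = j.succ :=
      ⟨c'.pred (Fin.ne_zero_of_lt hcc), by simp⟩
    have hij : i ≤ j := by
      simp only [Fin.lt_def, Fin.le_def, Fin.val_castSucc, Fin.val_succ] at *
      omega
    have hi : j.succ.succAbove i = i.castSucc := Fin.succAbove_of_castSucc_lt _ _ hcc
    -- The pair avoids both omitted vertices, so it lies in the common face, where `hk` applies.
    obtain ⟨r, rfl⟩ : ∃ r, i.succAbove r = p' := Fin.exists_succAbove_eq (by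
      rintro rfl
      exact Fin.succAbove_ne _ _ (hp.trans hi))
    obtain ⟨s, rfl⟩ : ∃ s, i.succAbove s = q' := Fin.exists_succAbove_eq (by
      rintro rfl
      exact Fin.succAbove_ne _ _ (hq.trans hi))
    rw [succAbove_comm hij, Fin.succAbove_right_inj] at hp hq
    subst hp hq
    have hrs : r ≤ s := (Fin.strictMono_succAbove i).le_iff_le.1 h'
    rw [← hd j r s hrs, ← hd i r s hrs, reassoc_of% (hk i j hij)]
  have hind : ∀ (c c' : Fin (n + 3)) (p q p' q' : Fin (n + 2)) (h : p ≤ q)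
      (h' : p' ≤ q'), c.succAbove p = c'.succAbove p' → c.succAbove q = c'.succAbove q' →
      k c ≫ z₁ p q h = k c' ≫ z₁ p' q' h' := by
    intro c c' p q p' q' h h' hp hq
    rcases lt_trichotomy c c' with hcc | rfl | hcc
    · exact hlt _ _ hcc _ _ _ _ _ _ hp hq
    · rw [Fin.succAbove_right_inj] at hp hq
      subst hp hq
      rfl
    · exact (hlt _ _ hcc _ _ _ _ _ _ hp.symm hq.symm).symm
  have hex : ∀ (i j : Fin (n + 3)) (_ : i ≤ j), ∃ y : Z ⟶ X, ∀ (c : Fin (n + 3))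
      (p q : Fin (n + 2)) (h : p ≤ q), c.succAbove p = i → c.succAbove q = j →
      k c ≫ z₁ p q h = y := by
    intro i j hij
    obtain ⟨c, hci, hcj⟩ : ∃ c, c ≠ i ∧ c ≠ j := Fin.exists_ne_and_ne_of_two_lt i j (by omega)
    obtain ⟨p, rfl⟩ := Fin.exists_succAbove_eq hci.symm
    obtain ⟨q, rfl⟩ := Fin.exists_succAbove_eq hcj.symm
    exact ⟨k c ≫ z₁ p q ((Fin.strictMono_succAbove c).le_iff_le.1 hij),
      fun c' p' q' h hp hq => hind _ _ _ _ _ _ _ _ hp hq⟩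
  choose y hy using hex
  exact ⟨y, fun c i j h => hy _ _ _ c i j h rfl rfl⟩

/-- Data and conditions involve at most two vertices at a time. With at least three vertices, each
pair lies in some face, so a zigzag is a compatible family of faces: the simplicial kernel of the
face morphisms one dimension lower. -/
theorem exists_isUniversalZigzag_add_two (hA : HasSimplicialKernels A) {a : X ⟶ Y} {f : X ⟶ Y'}
    {n : ℕ} {K₀ K₁ : A}
    {z₀ : ∀ i j : Fin (n + 1), i ≤ j → (K₀ ⟶ X)} {z₁ : ∀ i j : Fin (n + 2), i ≤ j → (K₁ ⟶ X)}
    (h₀ : IsUniversalZigzag a f z₀) (h₁ : IsUniversalZigzag a f z₁) :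
    ∃ (K : A) (z : ∀ i j : Fin (n + 3), i ≤ j → (K ⟶ X)), IsUniversalZigzag a f z := by
  have hd (c : Fin (n + 2)) :=
    h₀.exists_lift (h₁.1.reindex ⟨c.succAbove, (Fin.strictMono_succAbove c).monotone⟩)
  choose d hd using hd
  obtain ⟨K, k, hk, hu⟩ := hA d
  obtain ⟨z, hz⟩ := exists_glue hd hk
  have hpair : ∀ i j : Fin (n + 3), ∃ (c : Fin (n + 3)) (p q : Fin (n + 2)),
      c.succAbove p = i ∧ c.succAbove q = j := by
    intro i j
    obtain ⟨c, hci, hcj⟩ : ∃ c, c ≠ i ∧ c ≠ j := Fin.exists_ne_and_ne_of_two_lt i j (by omega)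
    obtain ⟨p, hp⟩ := Fin.exists_succAbove_eq hci.symm
    obtain ⟨q, hq⟩ := Fin.exists_succAbove_eq hcj.symm
    exact ⟨c, p, q, hp, hq⟩
  refine ⟨K, z, fun i j h => ?_, fun Z y hy => ?_⟩
  · obtain ⟨c, p, q, rfl, rfl⟩ := hpair i j
    have hpq : p ≤ q := (Fin.strictMono_succAbove c).le_iff_le.1 h
    have := h₁.1 p q hpq
    rw [← hz c p q hpq, ← hz c p p le_rfl, ← hz c q q le_rfl]
    simp [this]
  · have hx (c : Fin (n + 3)) :=
      h₁.exists_lift (hy.reindex ⟨c.succAbove, (Fin.strictMono_succAbove c).monotone⟩)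
    choose x hx using hx
    obtain ⟨u, hu, hu'⟩ := hu Z x (by
      intro i j hij
      refine h₀.hom_ext fun p q h => ?_
      rw [Category.assoc, Category.assoc, hd, hd]
      simp only [hx, OrderHom.coe_mk, succAbove_comm hij])
    refine ⟨u, fun i j h => ?_, fun w hw => ?_⟩
    · obtain ⟨c, p, q, rfl, rfl⟩ := hpair i j
      have hpq : p ≤ q := (Fin.strictMono_succAbove c).le_iff_le.1 h
      rw [← hz c p q hpq, reassoc_of% (hu c), hx]
      rfl
    · refine hu' w fun c => h₁.hom_ext fun i j h => ?_
      rw [Category.assoc, hz, hw, hx]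
      rfl

theorem exists_isUniversalZigzag (hA : HasSimplicialKernels A) {E : MorphismProperty A}
    (hE : IsExtensionClass E) {a : X ⟶ Y} {f : X ⟶ Y'} (ha : E a) (hf : E f) (n : ℕ) :
    ∃ (K : A) (z : ∀ i j : Fin (n + 1), i ≤ j → (K ⟶ X)), IsUniversalZigzag a f z := by
  induction n using Nat.twoStepInduction with
  | zero => exact exists_isUniversalZigzag_zero a f
  | one => exact exists_isUniversalZigzag_one hE a f ha hf
  | more n h₀ h₁ =>
    obtain ⟨K₀, z₀, h₀⟩ := h₀
    obtain ⟨K₁, z₁, h₁⟩ := h₁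
    exact exists_isUniversalZigzag_add_two hA h₀ h₁

theorem exists_simplicialObject_zigzag (hA : HasSimplicialKernels A) {E : MorphismProperty A}
    (hE : IsExtensionClass E) {a : X ⟶ Y} {f : X ⟶ Y'} (ha : E a) (hf : E f) :
    ∃ (S : SimplicialObject A) (z : ∀ (n : ℕ) (i j : Fin (n + 1)), i ≤ j →
      (S.obj (Opposite.op (SimplexCategory.mk n)) ⟶ X)),
      (∀ n, IsUniversalZigzag a f (z n)) ∧
      ∀ (n : ℕ) (c : Fin (n + 2)) (i j : Fin (n + 1)) (h : i ≤ j), S.δ c ≫ z n i j h =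
        z (n + 1) (c.succAbove i) (c.succAbove j) ((Fin.strictMono_succAbove c).monotone h) := by
  choose K z hz using exists_isUniversalZigzag hA hE ha hf
  have hm {m n : ℕ} (θ : Fin (m + 1) →o Fin (n + 1)) := (hz m).exists_lift ((hz n).1.reindex θ)
  choose map hmap using @hm
  exact ⟨{ obj := fun n => K n.unop.len
           map := fun θ => map θ.unop.toOrderHom
           map_id := fun n => (hz _).hom_ext fun i j h => by
            rw [hmap]
            simp
           map_comp := fun θ η => (hz _).hom_ext fun i j h => by
            rw [hmap, Category.assoc, hmap, hmap]
            simp },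
    z, hz, fun n c i j h => hmap _ i j h⟩

/-! ### From the Kan property to the Mal'tsev axiom -/

/-- In an `E`-Kan object, composable edges bound a simplex, up to a morphism in `E`. -/
theorem SemiSimplicial.IsKan.exists_inner_filler {E : MorphismProperty A}
    {S : SemiSimplicial A} (hS : S.IsKan E) (hE : IsExtensionClass E) {W : A}
    (y₁ y₂ : W ⟶ S.obj 1) (h : y₁ ≫ S.face 0 0 = y₂ ≫ S.face 0 1) :
    ∃ (Q : A) (e : Q ⟶ W) (r : Q ⟶ S.obj 2),
      E e ∧ r ≫ S.face 1 2 = e ≫ y₁ ∧ r ≫ S.face 1 0 = e ≫ y₂ := by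
  obtain ⟨H, x, ⟨-, hu⟩, c, hc, hEc⟩ := hS.2 0 1
  -- Index `1` is absent from this horn, so the second branch only concerns `i = 2`.
  obtain ⟨t, ht, -⟩ := hu W (fun i _ => if i = 0 then y₂ else y₁) (by
    intro i j hij hi hj
    fin_cases i <;> fin_cases j
    · exact absurd rfl hj
    · exact h
    · exact absurd hij (by decide)
    · exact absurd rfl hi)
  obtain ⟨Q, e, r, hQ⟩ := hE.exists_pullback t c hEc
  have hw := hQ.w
  refine ⟨Q, e, r, hE.of_pullback hQ hEc, ?_, ?_⟩
  · have h₁ := hc 2 (by decide)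
    have h₂ := ht 2 (by decide)
    rw [if_neg (by decide)] at h₂
    rw [← h₁, ← h₂, reassoc_of% hw]
  · have h₁ := hc 0 (by decide)
    have h₂ := ht 0 (by decide)
    rw [if_pos rfl] at h₂
    rw [← h₁, ← h₂, reassoc_of% hw]

theorem maltsevAxiom_of_isKan (hA : HasSimplicialKernels A) {E : MorphismProperty A}
    (hE : IsExtensionClass E)
    (hK : ∀ S : SimplicialObject A, (SemiSimplicial.ofSimplicial S).IsKan E) :
    MaltsevAxiom E := by
  intro A₁ B₁ A₀ B₀ f₁ a b f₀ s₁ s₀ ha hb hsq hsq' hs₁ hs₀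
  have hf₁ : E f₁ := hE.of_splitEpi s₁ hs₁
  have hf₀ : E f₀ := hE.of_splitEpi s₀ hs₀
  obtain ⟨P, p, q, hP⟩ := hE.exists_pullback f₀ b hb
  refine ⟨hsq, hf₁, ha, hb, hf₀, P, p, q, hP.lift a f₁ hsq.w.symm, hP, by simp, by simp,
    hE.of_pullback hP hb, hE.of_pullback hP.flip hf₀, ?_⟩
  -- An element of `W` is some `(x, y)` in `P` with a `w` such that `a w = x`. The edges `e₁` from
  -- `w` to `s₁ f₁ w` and `e₂` from there to `s₁ y` are composable; `e₂` uses `a s₁ f₁ w = s₀ f₀ x =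
  -- s₀ b y = a s₁ y`.
  obtain ⟨W, g, w₀, hW⟩ := hE.exists_pullback p a ha
  have hg : E g := hE.of_pullback hW ha
  obtain ⟨S, z, hz, hδ⟩ := exists_simplicialObject_zigzag hA hE ha hf₁
  have e₁ : IsZigzag a f₁ (n := 1) (fun i j _ => if j = 0 then w₀ else if i = 0 then w₀ else
      w₀ ≫ f₁ ≫ s₁) :=
    isZigzag_one (by simp) (by simp [hs₁])
  have e₂ : IsZigzag a f₁ (n := 1) (fun i j _ => if j = 0 then w₀ ≫ f₁ ≫ s₁ else
      g ≫ q ≫ s₁) := by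
    have h₁ := hsq'.w
    have h₂ := hP.w
    have h₃ := hW.w
    have h₄ := hsq.w
    have : g ≫ q ≫ s₁ ≫ a = w₀ ≫ f₁ ≫ s₁ ≫ a := by
      rw [h₁, ← reassoc_of% h₂, reassoc_of% h₃, reassoc_of% h₄]
    exact isZigzag_one (by simp [this]) (by simp)
  obtain ⟨y₁, hy₁⟩ := (hz 1).exists_lift e₁
  obtain ⟨y₂, hy₂⟩ := (hz 1).exists_lift e₂
  have hδ₁ : y₁ ≫ S.δ 0 = y₂ ≫ S.δ 1 := by
    refine (hz 0).hom_ext fun i j h => ?_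
    obtain rfl : i = 0 := Subsingleton.elim (α := Fin 1) _ _
    obtain rfl : j = 0 := Subsingleton.elim (α := Fin 1) _ _
    have h₁ : S.δ 0 ≫ z 0 0 0 le_rfl = z 1 1 1 le_rfl := hδ 0 0 0 0 le_rfl
    have h₂ : S.δ 1 ≫ z 0 0 0 le_rfl = z 1 0 0 le_rfl := hδ 0 1 0 0 le_rfl
    rw [Category.assoc, Category.assoc, h₁, h₂, hy₁, hy₂]
    simp
  obtain ⟨Q, e, r, hEe, hr₂, hr₀⟩ : ∃ (Q : A) (e : Q ⟶ W)
      (r : Q ⟶ S.obj (Opposite.op (SimplexCategory.mk 2))),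
      E e ∧ r ≫ S.δ 2 = e ≫ y₁ ∧ r ≫ S.δ 0 = e ≫ y₂ :=
    (hK S).exists_inner_filler hE y₁ y₂ hδ₁
  have key₀ : r ≫ z 2 0 0 le_rfl = e ≫ w₀ := by
    have : S.δ 2 ≫ z 1 0 0 le_rfl = z 2 0 0 le_rfl := hδ 1 2 0 0 le_rfl
    rw [← this, reassoc_of% hr₂, hy₁]
    simp
  have key₂ : r ≫ z 2 2 2 le_rfl = e ≫ g ≫ q ≫ s₁ := by
    have : S.δ 0 ≫ z 1 1 1 le_rfl = z 2 2 2 le_rfl := hδ 1 0 1 1 le_rfl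
    rw [← this, reassoc_of% hr₀, hy₂]
    simp
  -- The middle `z₀₂` of the composite edge has `a z₀₂ = a w = x` and `f₁ z₀₂ = f₁ s₁ y = y`, so it
  -- lies over `(x, y)`. Thus `e ≫ g`, which is in `E`, factors through the comparison morphism, and
  -- (E4) applies.
  refine hE.cancel (r ≫ z 2 0 2 (by decide)) _ ?_
  have : (r ≫ z 2 0 2 (by decide)) ≫ hP.lift a f₁ hsq.w.symm = e ≫ g := by
    obtain ⟨h₁, h₂⟩ := (hz 2).1 0 2 (by decide)
    apply hP.hom_ext
    · simp [h₁, reassoc_of% key₀, hW.w]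
    · simp [h₂, reassoc_of% key₂, hs₁]
  rw [this]
  exact hE.comp _ _ hEe hg

end RelMaltsev

theorem theorem3p11 {A : Type u} [Category.{v} A] (hA : RelMaltsev.HasSimplicialKernels A)
    (E : MorphismProperty A) (hE : RelMaltsev.IsExtensionClass E) :
    List.TFAE
      [RelMaltsev.MaltsevAxiom E,
        ∀ X : RelMaltsev.QuasiSimplicial A, X.toSemiSimplicial.IsKan E,
        ∀ X : SimplicialObject A, (RelMaltsev.SemiSimplicial.ofSimplicial X).IsKan E] := by
  tfae_have 1 → 2 := fun h X => X.isKan_of_maltsevAxiom hE h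
  tfae_have 2 → 3 := fun h X => h (RelMaltsev.QuasiSimplicial.ofSimplicial X)
  tfae_have 3 → 1 := RelMaltsev.maltsevAxiom_of_isKan hA hE
  tfae_finish
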